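/- **Lemma 1.6.** Let $A$ denote Lebesgue measure on $\mathbb R^2$, and let $r:\mathbb R^2\to\mathbb R$ be a function with $r-1\in L^1(\mathbb R^2)$. Then there exists a constant $c>0$, depending only on $r$, such that the following holds. Let $\mathcal Z$ be a translation-invariant point process on $\mathbb R^2$ (a random locally finite set of points whose law is invariant under all translations) with $1$-point function identically equal to $1$ and $2$-point function $\rho(z_1,z_2)=r(z_1-z_2)$; that is, $\rho(z_1,z_2)\ge 0$ for $z_1\neq z_2$, and $$\mathbb E\,\#(\mathcal Z\cap B)=A(B),\qquad \mathbb E\bigl[\#(\mathcal Z\cap B_1)\,\#(\mathcal Z\cap B_2)\bigr]=\int_{B_1\times B_2} r(z_1-z_2)\,dA(z_1)\,dA(z_2)$$ for every bounded Borel set $B$ and all disjoint bounded Borel sets $B_1,B_2\subset\mathbb R^2$. Then for every bounded Lebesgue measurable set $E\subset\mathbb R^2$ of positive area $A(E)$ and every $0<R<\infty$, the linear statistic $$n(R;\mathbf 1_E)=\sum_{a\in\mathcal Z}\mathbf 1_E\!\left(\frac aR\right)$$ is square-integrable, and its variance $$\sigma(R,\mathbf 1_E)^2=\mathbb E\Bigl\{\bigl(n(R;\mathbf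 1_E)-\mathbb E\,n(R;\mathbf 1_E)\bigr)^2\Bigr\}$$ satisfies $$\sigma(R,\mathbf 1_E)^2\ \ge\ c\,\min\bigl\{A(E)\,R^2,\ \sqrt{A(E)}\,R\bigr\}.$$ No regularity of $\partial E$ is assumed. -/

import Mathlib

open MeasureTheory ProbabilityTheory Bornology
open scoped ENNReal

/-- The plane `ℝ²` with its Euclidean norm and Lebesgue measure `volume`. -/
abbrev Plane : Type := EuclideanSpace ℝ (Fin 2)

/-- A locally finite configuration of points of the plane: a set of points that has only finitely
many points in every bounded set. -/
@[ext]
structure Configuration : Type where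
  /-- the set of points -/
  carrier : Set Plane
  finite_inter : ∀ B : Set Plane, IsBounded B → (carrier ∩ B).Finite

namespace Configuration

/-- The number `#(s ∩ B)` of points in `B` (used for bounded `B`, where it is finite). -/
noncomputable def count (s : Configuration) (B : Set Plane) : ℕ := (s.carrier ∩ B).ncard

/-- The usual σ-algebra on the space of configurations: the one generated by the counting
variables `s ↦ #(s ∩ B)`, with `B` a bounded Borel set. -/
noncomputable instance instMeasurableSpace : MeasurableSpace Configuration :=
  ⨆ (B : Set Plane) (_ : MeasurableSet B) (_ : IsBounded B),
    MeasurableSpace.comap (fun s : Configuration => s.count B) ⊤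

/-- The configuration `v + s`. -/
def translate (v : Plane) (s : Configuration) : Configuration where
  carrier := (fun z => v + z) '' s.carrier
  finite_inter := by
    intro B hB
    have hB' : IsBounded ((fun z => -v + z) '' B) :=
      ((isometry_add_left (-v)).lipschitz.isBounded_image hB)
    refine ((s.finite_inter _ hB').image (fun z => v + z)).subset ?_
    rintro _ ⟨⟨z, hz, rfl⟩, hzB⟩
    exact ⟨z, ⟨hz, ⟨v + z, hzB, by simp⟩⟩, rfl⟩

theorem measurable_count {B : Set Plane} (hB : MeasurableSet B) (hb : IsBounded B) :
    Measurable (fun s : Configuration => s.count B) := by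
  have h : MeasurableSpace.comap (fun s : Configuration => s.count B) ⊤ ≤ instMeasurableSpace :=
    le_iSup_of_le B (le_iSup_of_le hB (le_iSup_of_le hb le_rfl))
  exact fun t ht => h _ ⟨t, trivial, rfl⟩

theorem count_translate (v : Plane) (s : Configuration) (B : Set Plane) :
    (s.translate v).count B = s.count ((fun z => v + z) ⁻¹' B) := by
  unfold count translate
  rw [← Set.image_inter_preimage]
  exact Set.ncard_image_of_injective _ (add_right_injective v)

theorem measurable_translate (v : Plane) : Measurable (translate v) := by
  have key : ∀ B : Set Plane, MeasurableSet B → IsBounded B →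
      MeasurableSpace.comap (fun s : Configuration => s.count B) ⊤
        ≤ MeasurableSpace.map (translate v) instMeasurableSpace := by
    rintro B hB hb _ ⟨t, -, rfl⟩
    have hb' : IsBounded ((fun z => v + z) ⁻¹' B) :=
      (isometry_add_left v).antilipschitz.isBounded_preimage hb
    have hm := measurable_count ((measurable_const_add v) hB) hb'
    have := hm (MeasurableSet.of_discrete (s := t))
    change MeasurableSet[instMeasurableSpace] _
    simpa only [Set.preimage_preimage, count_translate] using this
  have : instMeasurableSpace ≤ MeasurableSpace.map (translate v) instMeasurableSpace :=
    iSup_le fun B => iSup_le fun hB => iSup_le fun hb => key B hB hb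
  exact fun t ht => this t ht

/-- The scaled linear statistic `n(R; h) = ∑_{a ∈ s} h(a / R)` of a configuration `s`
(a finite sum when `h` has bounded support and `R > 0`). -/
noncomputable def linearStatistic (R : ℝ) (h : Plane → ℝ) (s : Configuration) : ℝ :=
  ∑ᶠ a ∈ s.carrier, h (R⁻¹ • a)

end Configuration

section PointProcess

/-- A point process `Z` on the plane is translation-invariant if, for every vector `v`, the random
configurations `v + Z` and `Z` have the same law. -/
def IsTranslationInvariant {Ω : Type*} [MeasurableSpace Ω] (P : Measure Ω)
    (Z : Ω → Configuration) : Prop :=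
  ∀ v : Plane, P.map (fun ω => (Z ω).translate v) = P.map Z

/-- `ρ₁` is a one-point function of `Z`: it is non-negative and `E #(Z ∩ B) = ∫_B ρ₁` for all
bounded Borel sets `B`. -/
structure IsOnePointFunction {Ω : Type*} [MeasurableSpace Ω] (P : Measure Ω)
    (Z : Ω → Configuration) (ρ₁ : Plane → ℝ) : Prop where
  aemeasurable : AEMeasurable ρ₁ volume
  nonneg : ∀ z, 0 ≤ ρ₁ z
  lintegral_count : ∀ B : Set Plane, MeasurableSet B → IsBounded B →
    ∫⁻ ω, ((Z ω).count B : ℝ≥0∞) ∂P = ∫⁻ z in B, ENNReal.ofReal (ρ₁ z)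

/-- `ρ₂` is a two-point function of `Z`: it is non-negative off the diagonal and
`E [#(Z ∩ B₁) #(Z ∩ B₂)] = ∫_{B₁ × B₂} ρ₂` for all disjoint bounded Borel sets `B₁`, `B₂`.
(Its symmetry almost everywhere is a consequence.) -/
structure IsTwoPointFunction {Ω : Type*} [MeasurableSpace Ω] (P : Measure Ω)
    (Z : Ω → Configuration) (ρ₂ : Plane → Plane → ℝ) : Prop where
  aemeasurable : AEMeasurable (fun p : Plane × Plane => ρ₂ p.1 p.2) volume
  nonneg : ∀ z₁ z₂, z₁ ≠ z₂ → 0 ≤ ρ₂ z₁ z₂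
  lintegral_count_mul_count : ∀ B₁ B₂ : Set Plane, MeasurableSet B₁ → IsBounded B₁ →
    MeasurableSet B₂ → IsBounded B₂ → Disjoint B₁ B₂ →
    ∫⁻ ω, ((Z ω).count B₁ : ℝ≥0∞) * ((Z ω).count B₂ : ℝ≥0∞) ∂P
      = ∫⁻ p in B₁ ×ˢ B₂, ENNReal.ofReal (ρ₂ p.1 p.2)

/-- The variance `σ(R; h)²` of the linear statistic `n(R; h)` of the point process `Z`. -/
noncomputable def sigmaSq {Ω : Type*} [MeasurableSpace Ω] (P : Measure Ω)
    (Z : Ω → Configuration) (R : ℝ) (h : Plane → ℝ) : ℝ :=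
  ∫ ω, ((Z ω).linearStatistic R h - ∫ ω', (Z ω').linearStatistic R h ∂P) ^ 2 ∂P

end PointProcess

/-! Let F be the dilated set, κ = δ₀ + (r - 1) dA the covariance measure, and q = 𝟙_F ∗ κ = 𝟙_F - g,
where g = -𝟙_F ∗ (r - 1). For bounded Borel A the covariance of #(Z ∩ A) and #(Z ∩ F) is ∫_A q
(`covariance_count`), while Var #(Z ∩ A) ≤ (1 + ‖r - 1‖₁)|A|. Cauchy–Schwarz, with A a part of {|q|
≥ t} where q has one sign, bounds the area of {|q| ≥ t} by a multiple of Var #(Z ∩ F)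
(`volume_le_ofReal_variance_count`).

It remains to see that 𝟙_F cannot be close to g too often: g has a modulus of continuity depending
only on r, whereas 𝟙_F jumps. Let D = {|𝟙_F - g| ≥ 1/4}. Points of F with g < 3/4 lie in D. An
axis-parallel line through a point with g ≥ 3/4 meets D in length at least 2δ: along it g either
takes the value 1/2, and then stays in [1/4, 3/4] up to distance δ, or exceeds 1/2 even far outside
the bounded set F. A Loomis–Whitney argument gives 4δ²|{g ≥ 3/4}| ≤ |D|²
(`sq_mul_volume_superlevel_le`). Hence |F| ≤ |D| + |D|²/(4δ²), so |D| is at least a multiple of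
min(|F|, √|F|). -/

/-! ### Exhausting the off-diagonal by products of disjoint cells -/

section OffDiagonal

open MeasurableSpace

variable {α : Type*} [MeasurableSpace α] [CountablyGenerated α]

/-- The pairs of points that the `n`-th countable partition separates. -/
def separatedPairs (α : Type*) [MeasurableSpace α] [CountablyGenerated α] (n : ℕ) : Set (α × α) :=
  {p | countablePartitionSet n p.1 ≠ countablePartitionSet n p.2}

/-- The pairs of distinct cells of the `n`-th countable partition. -/
noncomputable def cellPairs (α : Type*) [MeasurableSpace α] [CountablyGenerated α] (n : ℕ) :
    Finset (Set α × Set α) :=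
  open Classical in (finite_countablePartition α n).toFinset.offDiag

theorem mem_cellPairs {n : ℕ} {q : Set α × Set α} :
    q ∈ cellPairs α n ↔
      q.1 ∈ countablePartition α n ∧ q.2 ∈ countablePartition α n ∧ q.1 ≠ q.2 := by
  simp [cellPairs, Finset.mem_offDiag]

theorem separatedPairs_eq_biUnion (n : ℕ) :
    separatedPairs α n = ⋃ q ∈ cellPairs α n, q.1 ×ˢ q.2 := by
  ext ⟨a, b⟩
  simp only [separatedPairs, Set.mem_ofPred_eq, Set.mem_iUnion, Set.mem_prod, exists_prop]
  constructor
  · intro h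
    exact ⟨(countablePartitionSet n a, countablePartitionSet n b),
      mem_cellPairs.2 ⟨countablePartitionSet_mem n a, countablePartitionSet_mem n b, h⟩,
      mem_countablePartitionSet n a, mem_countablePartitionSet n b⟩
  · rintro ⟨q, hq, ha, hb⟩
    obtain ⟨h1, h2, h⟩ := mem_cellPairs.1 hq
    rwa [countablePartitionSet_of_mem h1 ha, countablePartitionSet_of_mem h2 hb]

theorem measure_separatedPairs (m : Measure (α × α)) (n : ℕ) :
    m (separatedPairs α n) = ∑ q ∈ cellPairs α n, m (q.1 ×ˢ q.2) := by
  rw [separatedPairs_eq_biUnion, measure_biUnion_finset]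
  · intro q hq q' hq' hne
    obtain ⟨h1, h2, -⟩ := mem_cellPairs.1 hq
    obtain ⟨h1', h2', -⟩ := mem_cellPairs.1 hq'
    refine Set.disjoint_prod.2 ?_
    by_contra! hcon
    refine hne (Prod.ext ?_ ?_)
    · by_contra hh
      exact hcon.1 (disjoint_countablePartition h1 h1' hh)
    · by_contra hh
      exact hcon.2 (disjoint_countablePartition h2 h2' hh)
  · intro q hq
    obtain ⟨h1, h2, -⟩ := mem_cellPairs.1 hq
    exact (measurableSet_countablePartition n h1).prod (measurableSet_countablePartition n h2)

/-- Each cell of one level is a union of cells of the next, so separated points stay separated. -/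
theorem monotone_separatedPairs : Monotone (separatedPairs α) := by
  refine monotone_nat_of_le_succ fun n => ?_
  rintro ⟨a, b⟩ hab hsucc
  refine hab ?_
  obtain ⟨S, hS, hSeq⟩ := (measurableSet_generateFrom_countablePartition_iff (n + 1) _).1
    (measurableSet_succ_countablePartition n (countablePartitionSet_mem n a))
  have ha : a ∈ ⋃₀ (S : Set (Set α)) := hSeq ▸ mem_countablePartitionSet n a
  obtain ⟨T, hT, haT⟩ := ha
  have hb : b ∈ countablePartitionSet n a := by
    rw [hSeq]
    refine ⟨T, hT, ?_⟩
    rw [← countablePartitionSet_of_mem (hS hT) haT]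
    simp only at hsucc
    rw [hsucc]
    exact mem_countablePartitionSet _ b
  exact (countablePartitionSet_of_mem (countablePartitionSet_mem n a) hb).symm

theorem iUnion_separatedPairs [SeparatesPoints α] :
    ⋃ n, separatedPairs α n = (Set.diagonal α)ᶜ := by
  ext ⟨a, b⟩
  simp only [Set.mem_iUnion, separatedPairs, Set.mem_ofPred_eq, Set.mem_compl_iff,
    Set.mem_diagonal_iff]
  constructor
  · rintro ⟨n, hn⟩ rfl
    exact hn rfl
  · contrapose!
    intro h
    have hsep : @SeparatesPoints α (generateFrom (⋃ n, countablePartition α n)) := by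
      rw [generateFrom_iUnion_countablePartition]
      infer_instance
    refine separating_of_generateFrom (⋃ n, countablePartition α n) a b fun s hs => ?_
    obtain ⟨n, hn⟩ := Set.mem_iUnion.1 hs
    rw [← countablePartitionSet_eq_iff a hn, h n, countablePartitionSet_eq_iff b hn]

/-- This recovers the off-diagonal mass from products of disjoint sets, the only products on which a
two-point function is prescribed. -/
theorem iSup_sum_cellPairs [SeparatesPoints α] (m : Measure (α × α)) :
    ⨆ n, ∑ q ∈ cellPairs α n, m (q.1 ×ˢ q.2) = m (Set.diagonal α)ᶜ := by
  simp_rw [← measure_separatedPairs]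
  rw [← iUnion_separatedPairs, monotone_separatedPairs.measure_iUnion]

theorem monotone_sum_cellPairs (m : Measure (α × α)) :
    Monotone fun n => ∑ q ∈ cellPairs α n, m (q.1 ×ˢ q.2) := by
  intro i j hij
  simp_rw [← measure_separatedPairs]
  exact measure_mono (monotone_separatedPairs hij)

end OffDiagonal

/-! ### Pairs of points of a configuration -/

namespace Configuration

/-- The counting measure of the points of the configuration that lie in `B`. -/
noncomputable def measureOn (s : Configuration) (B : Set Plane) : Measure Plane :=
  Measure.count.restrict (s.carrier ∩ B)

theorem measureOn_apply (s : Configuration) {B : Set Plane} (hB : IsBounded B) {S : Set Plane}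
    (hS : MeasurableSet S) : s.measureOn B S = s.count (B ∩ S) := by
  have hfin : (s.carrier ∩ (B ∩ S)).Finite := s.finite_inter _ (hB.subset Set.inter_subset_left)
  rw [measureOn, Measure.restrict_apply hS, Set.inter_comm, Set.inter_assoc,
    Measure.count_apply_finite _ hfin, count, Set.ncard_eq_toFinset_card _ hfin]

theorem isFiniteMeasure_measureOn (s : Configuration) {B : Set Plane} (hB : IsBounded B) :
    IsFiniteMeasure (s.measureOn B) :=
  ⟨by rw [measureOn_apply s hB .univ]; exact ENNReal.natCast_lt_top _⟩

/-- The pairs on the diagonal are the points common to both sets; every other pair is off-diagonal.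
-/
theorem prod_measureOn_compl_diagonal (s : Configuration) {B₁ B₂ : Set Plane}
    (h₁ : IsBounded B₁) (h₂ : IsBounded B₂) (hB₂ : MeasurableSet B₂) :
    ((s.measureOn B₁).prod (s.measureOn B₂)) (Set.diagonal Plane)ᶜ + s.count (B₁ ∩ B₂)
      = s.count B₁ * s.count B₂ := by
  have := s.isFiniteMeasure_measureOn h₁
  have := s.isFiniteMeasure_measureOn h₂
  have hd : ((s.measureOn B₁).prod (s.measureOn B₂)) (Set.diagonal Plane) = s.count (B₁ ∩ B₂) := by
    rw [Measure.prod_apply measurableSet_diagonal]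
    have hfib : ∀ x, Prod.mk x ⁻¹' Set.diagonal Plane = {x} := by
      intro x; ext y; simp [eq_comm]
    simp_rw [hfib]
    rw [← s.measureOn_apply h₁ hB₂, ← lintegral_indicator_one hB₂]
    have hm : MeasurableSet (s.carrier ∩ B₁) := (s.finite_inter _ h₁).measurableSet
    refine setLIntegral_congr_fun hm fun x hx => ?_
    rw [measureOn_apply s h₂ (measurableSet_singleton x), count]
    by_cases hxB : x ∈ B₂
    · have : s.carrier ∩ (B₂ ∩ {x}) = {x} := by
        ext y; simp only [Set.mem_inter_iff, Set.mem_singleton_iff]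
        exact ⟨fun h => h.2.2, fun h => ⟨h ▸ hx.1, h ▸ hxB, h⟩⟩
      rw [this]; simp [hxB]
    · have : s.carrier ∩ (B₂ ∩ {x}) = ∅ := by
        ext y; simp only [Set.mem_inter_iff, Set.mem_singleton_iff, Set.mem_empty_iff_false,
          iff_false]
        exact fun h => hxB (h.2.2 ▸ h.2.1)
      rw [this]; simp [hxB]
  rw [← hd, add_comm, measure_add_measure_compl measurableSet_diagonal, ← Set.univ_prod_univ,
    Measure.prod_prod, measureOn_apply s h₁ .univ, measureOn_apply s h₂ .univ]
  simp

end Configuration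

/-! ### Second moments for overlapping sets -/

section Moments

variable {Ω : Type*} [MeasurableSpace Ω] {P : Measure Ω} {Z : Ω → Configuration}

theorem measurable_count_comp (hZ : Measurable Z) {B : Set Plane} (hB : MeasurableSet B)
    (hb : IsBounded B) : Measurable fun ω => ((Z ω).count B : ℝ≥0∞) :=
  measurable_from_top.comp ((Configuration.measurable_count hB hb).comp hZ)

/-- The second mixed moment of the counting variables of two sets that may overlap. -/
theorem IsTwoPointFunction.lintegral_count_mul_count' {ρ₂ : Plane → Plane → ℝ}
    (hZ : Measurable Z) (h2 : IsTwoPointFunction P Z ρ₂)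
    {B₁ B₂ : Set Plane} (hB₁ : MeasurableSet B₁) (hb₁ : IsBounded B₁)
    (hB₂ : MeasurableSet B₂) (hb₂ : IsBounded B₂) :
    ∫⁻ ω, ((Z ω).count B₁ : ℝ≥0∞) * ((Z ω).count B₂ : ℝ≥0∞) ∂P
      = (∫⁻ p in B₁ ×ˢ B₂, ENNReal.ofReal (ρ₂ p.1 p.2)) + ∫⁻ ω, ((Z ω).count (B₁ ∩ B₂) : ℝ≥0∞) ∂P := by
  set m : Measure (Plane × Plane) :=
    (volume.restrict (B₁ ×ˢ B₂)).withDensity fun p => ENNReal.ofReal (ρ₂ p.1 p.2) with hm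
  have hcell : ∀ ω, ∀ n, ∀ q ∈ cellPairs Plane n,
      ((Z ω).measureOn B₁).prod ((Z ω).measureOn B₂) (q.1 ×ˢ q.2)
        = ((Z ω).count (B₁ ∩ q.1) : ℝ≥0∞) * ((Z ω).count (B₂ ∩ q.2) : ℝ≥0∞) := by
    intro ω n q hq
    obtain ⟨hq1, hq2, -⟩ := mem_cellPairs.1 hq
    have := (Z ω).isFiniteMeasure_measureOn hb₁
    have := (Z ω).isFiniteMeasure_measureOn hb₂
    rw [Measure.prod_prod,
      Configuration.measureOn_apply _ hb₁ (MeasurableSpace.measurableSet_countablePartition n hq1),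
      Configuration.measureOn_apply _ hb₂ (MeasurableSpace.measurableSet_countablePartition n hq2)]
  have hcount : ∀ (B : Set Plane) (S : Set Plane), MeasurableSet B → IsBounded B → ∀ n,
      S ∈ MeasurableSpace.countablePartition Plane n →
      Measurable fun ω => ((Z ω).count (B ∩ S) : ℝ≥0∞) := fun B S hB hb n hS =>
    measurable_count_comp hZ (hB.inter (MeasurableSpace.measurableSet_countablePartition n hS))
      (hb.subset Set.inter_subset_left)
  have hterm : ∀ n, ∀ q ∈ cellPairs Plane n,
      Measurable fun ω => ((Z ω).measureOn B₁).prod ((Z ω).measureOn B₂) (q.1 ×ˢ q.2) := by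
    intro n q hq
    simp_rw [hcell _ n q hq]
    obtain ⟨hq1, hq2, -⟩ := mem_cellPairs.1 hq
    exact (hcount _ _ hB₁ hb₁ n hq1).mul (hcount _ _ hB₂ hb₂ n hq2)
  -- Distinct cells cut B₁ and B₂ in disjoint sets, where the two-point function applies; monotone
  -- convergence over the levels does the rest.
  have hoff : ∫⁻ ω, ((Z ω).measureOn B₁).prod ((Z ω).measureOn B₂) (Set.diagonal Plane)ᶜ ∂P
      = m (Set.diagonal Plane)ᶜ := by
    simp_rw [← iSup_sum_cellPairs]
    rw [lintegral_iSup (fun n => Finset.measurable_sum _ (hterm n))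
      (fun i j hij ω => monotone_sum_cellPairs _ hij)]
    refine iSup_congr fun n => ?_
    rw [lintegral_finsetSum' _ fun q hq => (hterm n q hq).aemeasurable]
    refine Finset.sum_congr rfl fun q hq => ?_
    simp_rw [hcell _ n q hq]
    obtain ⟨hq1, hq2, hne⟩ := mem_cellPairs.1 hq
    have hm1 := MeasurableSpace.measurableSet_countablePartition n hq1
    have hm2 := MeasurableSpace.measurableSet_countablePartition n hq2
    rw [h2.lintegral_count_mul_count _ _ (hB₁.inter hm1) (hb₁.subset Set.inter_subset_left)
      (hB₂.inter hm2) (hb₂.subset Set.inter_subset_left)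
      ((MeasurableSpace.disjoint_countablePartition hq1 hq2 hne).mono Set.inter_subset_right
        Set.inter_subset_right),
      hm, withDensity_apply _ (hm1.prod hm2), Measure.restrict_restrict (hm1.prod hm2),
      Set.prod_inter_prod, Set.inter_comm q.1, Set.inter_comm q.2]
  have hdiag : (volume : Measure (Plane × Plane)) (Set.diagonal Plane) = 0 := by
    rw [Measure.volume_eq_prod, Measure.measure_prod_null measurableSet_diagonal]
    refine Filter.Eventually.of_forall fun x => ?_
    have : Prod.mk x ⁻¹' Set.diagonal Plane = {x} := by ext y; simp [eq_comm]
    simp [this]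
  have hmd : m (Set.diagonal Plane)ᶜ = ∫⁻ p in B₁ ×ˢ B₂, ENNReal.ofReal (ρ₂ p.1 p.2) := by
    have h0 : m (Set.diagonal Plane) = 0 :=
      ((withDensity_absolutelyContinuous _ _).trans Measure.absolutelyContinuous_restrict) hdiag
    have := measure_add_measure_compl (μ := m) (measurableSet_diagonal (α := Plane))
    rw [h0, zero_add] at this
    rw [this, hm, withDensity_apply _ .univ, Measure.restrict_univ]
  rw [← hmd, ← hoff, ← lintegral_add_right _
    (measurable_count_comp hZ (hB₁.inter hB₂) (hb₁.subset Set.inter_subset_left))]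
  refine lintegral_congr fun ω => ?_
  rw [(Z ω).prod_measureOn_compl_diagonal hb₁ hb₂ hB₂]

end Moments

/-- The Cauchy–Schwarz inequality for covariances. -/
theorem sq_covariance_le {Ω : Type*} [MeasurableSpace Ω] {P : Measure Ω} [IsProbabilityMeasure P]
    {X Y : Ω → ℝ} (hX : MemLp X 2 P) (hY : MemLp Y 2 P) :
    cov[X, Y; P] ^ 2 ≤ Var[X; P] * Var[Y; P] := by
  -- The quadratic polynomial is Var(X + tY), so its discriminant is not positive.
  have h : ∀ t : ℝ, 0 ≤ Var[Y; P] * (t * t) + (2 * cov[X, Y; P]) * t + Var[X; P] := by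
    intro t
    have h0 := variance_nonneg (fun ω => X ω + t * Y ω) P
    have := variance_fun_add hX (hY.const_mul t)
    rw [variance_const_mul, covariance_const_mul_right] at this
    linarith
  have := discrim_le_zero h
  rw [discrim] at this
  nlinarith

/-! ### Covariances of counting variables -/

section Moments

variable {Ω : Type*} [MeasurableSpace Ω] {P : Measure Ω} {Z : Ω → Configuration} {r : Plane → ℝ}

theorem lintegral_count_eq_volume (h1 : IsOnePointFunction P Z fun _ => 1) {B : Set Plane}
    (hB : MeasurableSet B) (hb : IsBounded B) :
    ∫⁻ ω, ((Z ω).count B : ℝ≥0∞) ∂P = volume B := by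
  simp [h1.lintegral_count B hB hb]

theorem integrable_prod_indicator_sub {k : Plane → ℝ} (hk : Integrable k volume) {B : Set Plane}
    (hB : MeasurableSet B) (hb : IsBounded B) :
    Integrable (fun p : Plane × Plane => B.indicator (fun _ => (1 : ℝ)) p.2 * k (p.1 - p.2))
      (volume.prod volume) :=
  Integrable.convolution_integrand (ContinuousLinearMap.mul ℝ ℝ)
    ((integrable_indicator_iff hB).2 (integrableOn_const hb.measure_lt_top.ne)) hk

theorem integrableOn_prod_sub {k : Plane → ℝ} (hk : Integrable k volume) {B₁ B₂ : Set Plane}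
    (hB₁ : MeasurableSet B₁) (hB₂ : MeasurableSet B₂) (hb₂ : IsBounded B₂) :
    IntegrableOn (fun p : Plane × Plane => k (p.1 - p.2)) (B₁ ×ˢ B₂) volume := by
  refine ((integrable_prod_indicator_sub hk hB₂ hb₂).integrableOn (s := B₁ ×ˢ B₂)).congr_fun
    (fun p hp => ?_) (hB₁.prod hB₂)
  simp [hp.2]

theorem integrableOn_prod_sub_of_sub_one (hr : Integrable (fun z => r z - 1) volume)
    {B₁ B₂ : Set Plane} (hB₁ : MeasurableSet B₁) (hb₁ : IsBounded B₁)
    (hB₂ : MeasurableSet B₂) (hb₂ : IsBounded B₂) :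
    IntegrableOn (fun p : Plane × Plane => r (p.1 - p.2)) (B₁ ×ˢ B₂) volume := by
  have h := (integrableOn_prod_sub hr hB₁ hB₂ hb₂).add
    (integrableOn_const (C := (1 : ℝ)) (hb₁.prod hb₂).measure_lt_top.ne)
  exact h.congr (Filter.Eventually.of_forall fun p => by simp)

/-- The sign of r(0) is unknown, but it is seen only on the diagonal, which is null. -/
theorem ae_nonneg_comp_sub (h2 : IsTwoPointFunction P Z fun z₁ z₂ => r (z₁ - z₂)) :
    ∀ᵐ p : Plane × Plane, 0 ≤ r (p.1 - p.2) := by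
  have hdiag : (volume : Measure (Plane × Plane)) (Set.diagonal Plane) = 0 := by
    rw [Measure.volume_eq_prod, Measure.measure_prod_null measurableSet_diagonal]
    refine Filter.Eventually.of_forall fun x => ?_
    have : Prod.mk x ⁻¹' Set.diagonal Plane = {x} := by ext y; simp [eq_comm]
    simp [this]
  filter_upwards [measure_eq_zero_iff_ae_notMem.1 hdiag] with p hp
  exact h2.nonneg _ _ hp

theorem lintegral_count_mul_count_eq_ofReal (hr : Integrable (fun z => r z - 1) volume)
    (hZ : Measurable Z) (h1 : IsOnePointFunction P Z fun _ => 1)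
    (h2 : IsTwoPointFunction P Z fun z₁ z₂ => r (z₁ - z₂))
    {B₁ B₂ : Set Plane} (hB₁ : MeasurableSet B₁) (hb₁ : IsBounded B₁)
    (hB₂ : MeasurableSet B₂) (hb₂ : IsBounded B₂) :
    ∫⁻ ω, ((Z ω).count B₁ : ℝ≥0∞) * ((Z ω).count B₂ : ℝ≥0∞) ∂P
      = ENNReal.ofReal ((∫ p in B₁ ×ˢ B₂, r (p.1 - p.2)) + volume.real (B₁ ∩ B₂)) := by
  have hb : IsBounded (B₁ ∩ B₂) := hb₁.subset Set.inter_subset_left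
  have hnn := ae_restrict_of_ae (s := B₁ ×ˢ B₂) (ae_nonneg_comp_sub h2)
  rw [h2.lintegral_count_mul_count' hZ hB₁ hb₁ hB₂ hb₂,
    lintegral_count_eq_volume h1 (hB₁.inter hB₂) hb,
    ENNReal.ofReal_add (integral_nonneg_of_ae hnn) measureReal_nonneg,
    ofReal_integral_eq_lintegral_ofReal
      (integrableOn_prod_sub_of_sub_one hr hB₁ hb₁ hB₂ hb₂) hnn,
    ofReal_measureReal hb.measure_lt_top.ne]

theorem memLp_count (hr : Integrable (fun z => r z - 1) volume)
    (hZ : Measurable Z) (h1 : IsOnePointFunction P Z fun _ => 1)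
    (h2 : IsTwoPointFunction P Z fun z₁ z₂ => r (z₁ - z₂))
    {B : Set Plane} (hB : MeasurableSet B) (hb : IsBounded B) :
    MemLp (fun ω => ((Z ω).count B : ℝ)) 2 P := by
  have hm : Measurable fun ω => ((Z ω).count B : ℝ) :=
    measurable_from_top.comp ((Configuration.measurable_count hB hb).comp hZ)
  rw [memLp_two_iff_integrable_sq hm.aestronglyMeasurable]
  refine ⟨(hm.pow_const 2).aestronglyMeasurable, ?_⟩
  rw [hasFiniteIntegral_iff_ofReal (Filter.Eventually.of_forall fun ω => sq_nonneg _)]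
  have : ∀ ω, ENNReal.ofReal (((Z ω).count B : ℝ) ^ 2)
      = ((Z ω).count B : ℝ≥0∞) * ((Z ω).count B : ℝ≥0∞) := fun ω => by
    rw [ENNReal.ofReal_pow (by positivity), ENNReal.ofReal_natCast, sq]
  simp_rw [this, lintegral_count_mul_count_eq_ofReal hr hZ h1 h2 hB hb hB hb]
  exact ENNReal.ofReal_lt_top

theorem integral_count (h1 : IsOnePointFunction P Z fun _ => 1)
    (hZ : Measurable Z) {B : Set Plane} (hB : MeasurableSet B) (hb : IsBounded B) :
    ∫ ω, ((Z ω).count B : ℝ) ∂P = volume.real B := by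
  have hm : Measurable fun ω => ((Z ω).count B : ℝ) :=
    measurable_from_top.comp ((Configuration.measurable_count hB hb).comp hZ)
  rw [integral_eq_lintegral_of_nonneg_ae (Filter.Eventually.of_forall fun ω => by positivity)
    hm.aestronglyMeasurable]
  simp_rw [ENNReal.ofReal_natCast]
  rw [lintegral_count_eq_volume h1 hB hb, Measure.real]

/-- The covariance of two counting variables, in terms of the truncated two-point function. -/
theorem covariance_count [IsProbabilityMeasure P] (hr : Integrable (fun z => r z - 1) volume)
    (hZ : Measurable Z) (h1 : IsOnePointFunction P Z fun _ => 1)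
    (h2 : IsTwoPointFunction P Z fun z₁ z₂ => r (z₁ - z₂))
    {B₁ B₂ : Set Plane} (hB₁ : MeasurableSet B₁) (hb₁ : IsBounded B₁)
    (hB₂ : MeasurableSet B₂) (hb₂ : IsBounded B₂) :
    cov[fun ω => ((Z ω).count B₁ : ℝ), fun ω => ((Z ω).count B₂ : ℝ); P]
      = ∫ x in B₁, (B₂.indicator 1 x + ∫ y in B₂, (r (x - y) - 1)) := by
  have hL := memLp_count hr hZ h1 h2 hB₁ hb₁
  have hL' := memLp_count hr hZ h1 h2 hB₂ hb₂
  have hnn := ae_restrict_of_ae (s := B₁ ×ˢ B₂) (ae_nonneg_comp_sub h2)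
  have hprod : ∫ ω, ((Z ω).count B₁ : ℝ) * ((Z ω).count B₂ : ℝ) ∂P
      = (∫ p in B₁ ×ˢ B₂, r (p.1 - p.2)) + volume.real (B₁ ∩ B₂) := by
    rw [integral_eq_lintegral_of_nonneg_ae (Filter.Eventually.of_forall fun ω => by
        simp only [Pi.zero_apply]; positivity)
      (by exact hL.1.mul hL'.1)]
    simp_rw [ENNReal.ofReal_mul (Nat.cast_nonneg _), ENNReal.ofReal_natCast]
    rw [lintegral_count_mul_count_eq_ofReal hr hZ h1 h2 hB₁ hb₁ hB₂ hb₂, ENNReal.toReal_ofReal]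
    exact add_nonneg (integral_nonneg_of_ae hnn) measureReal_nonneg
  have hk := integrableOn_prod_sub hr hB₁ hB₂ hb₂
  have hI : (∫ p in B₁ ×ˢ B₂, (r (p.1 - p.2) - 1))
      = (∫ p in B₁ ×ˢ B₂, r (p.1 - p.2)) - volume.real B₁ * volume.real B₂ := by
    rw [integral_sub (integrableOn_prod_sub_of_sub_one hr hB₁ hb₁ hB₂ hb₂)
      (integrableOn_const (hb₁.prod hb₂).measure_lt_top.ne)]
    simp [Measure.volume_eq_prod, measureReal_prod_prod]
  have hk' : IntegrableOn (fun x => ∫ y in B₂, (r (x - y) - 1)) B₁ volume := by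
    rw [IntegrableOn, Measure.volume_eq_prod, ← Measure.prod_restrict] at hk
    exact hk.integral_prod_left
  have hind : IntegrableOn (B₂.indicator (1 : Plane → ℝ)) B₁ volume :=
    ((integrable_indicator_iff hB₂).2
      (integrableOn_const (C := (1 : ℝ)) hb₂.measure_lt_top.ne)).integrableOn
  rw [covariance_eq_sub hL hL', integral_count h1 hZ hB₁ hb₁, integral_count h1 hZ hB₂ hb₂]
  simp only [Pi.mul_apply]
  rw [hprod, integral_add hind hk',
    setIntegral_indicator hB₂, ← setIntegral_prod (fun p : Plane × Plane => r (p.1 - p.2) - 1)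
      (by simpa [Measure.volume_eq_prod] using hk), ← Measure.volume_eq_prod, hI]
  simp
  ring

theorem abs_setIntegral_sub_le {k : Plane → ℝ} (hk : Integrable k volume) (B : Set Plane)
    (x : Plane) : |∫ y in B, k (x - y)| ≤ ∫ z, |k z| := by
  calc |∫ y in B, k (x - y)| ≤ ∫ y in B, |k (x - y)| := abs_integral_le_integral_abs
    _ ≤ ∫ y, |k (x - y)| :=
      setIntegral_le_integral (hk.comp_sub_left x).abs
        (Filter.Eventually.of_forall fun y => abs_nonneg _)
    _ = ∫ z, |k z| := integral_sub_left_eq_self (fun z => |k z|) volume x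

/-- The convolution of 𝟙_B with the covariance measure is bounded by the total variation 1 + ‖r -
1‖₁. -/
theorem variance_count_le [IsProbabilityMeasure P] (hr : Integrable (fun z => r z - 1) volume)
    (hZ : Measurable Z) (h1 : IsOnePointFunction P Z fun _ => 1)
    (h2 : IsTwoPointFunction P Z fun z₁ z₂ => r (z₁ - z₂))
    {B : Set Plane} (hB : MeasurableSet B) (hb : IsBounded B) :
    Var[fun ω => ((Z ω).count B : ℝ); P] ≤ (1 + ∫ z, |r z - 1|) * volume.real B := by
  rw [← covariance_self (memLp_count hr hZ h1 h2 hB hb).aemeasurable,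
    covariance_count hr hZ h1 h2 hB hb hB hb]
  have := norm_setIntegral_le_of_norm_le_const (μ := volume) (s := B)
    (f := fun x => B.indicator 1 x + ∫ y in B, (r (x - y) - 1)) (C := 1 + ∫ z, |r z - 1|)
    hb.measure_lt_top fun x hx => by
      rw [Set.indicator_of_mem hx]
      refine (norm_add_le _ _).trans (add_le_add (by simp) ?_)
      exact abs_setIntegral_sub_le hr B x
  exact (le_abs_self _).trans this

/-- A set on which the convolution of `𝟙_F` with the covariance measure has constant sign and
modulus at least `t` gives a lower bound of the variance of `#(Z ∩ F)`. -/
theorem volume_le_variance_count [IsProbabilityMeasure P]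
    (hr : Integrable (fun z => r z - 1) volume)
    (hZ : Measurable Z) (h1 : IsOnePointFunction P Z fun _ => 1)
    (h2 : IsTwoPointFunction P Z fun z₁ z₂ => r (z₁ - z₂))
    {A F : Set Plane} (hA : MeasurableSet A) (hbA : IsBounded A)
    (hF : MeasurableSet F) (hbF : IsBounded F) {t : ℝ} (ht : 0 ≤ t)
    (h : t * volume.real A ≤ |∫ x in A, (F.indicator 1 x + ∫ y in F, (r (x - y) - 1))|) :
    t ^ 2 * volume.real A
      ≤ (1 + ∫ z, |r z - 1|) * Var[fun ω => ((Z ω).count F : ℝ); P] := by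
  have hK : 0 ≤ ∫ z, |r z - 1| := integral_nonneg fun z => abs_nonneg _
  have hV := variance_nonneg (fun ω => ((Z ω).count F : ℝ)) P
  rcases (measureReal_nonneg : 0 ≤ volume.real A).eq_or_lt with h0 | h0
  · rw [← h0]; simp only [mul_zero]; positivity
  -- With K = ‖r - 1‖₁, t²|A|² ≤ Cov² ≤ Var #(Z ∩ A) · Var #(Z ∩ F) ≤ (1 + K)|A| · Var #(Z ∩ F), and
  -- one factor |A| cancels.
  have hcs := sq_covariance_le (memLp_count hr hZ h1 h2 hA hbA) (memLp_count hr hZ h1 h2 hF hbF)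
  rw [covariance_count hr hZ h1 h2 hA hbA hF hbF, ← sq_abs] at hcs
  have hsq := pow_le_pow_left₀ (by positivity) h 2
  have hA' := mul_le_mul_of_nonneg_right (variance_count_le hr hZ h1 h2 hA hbA) hV
  refine le_of_mul_le_mul_right ?_ h0
  nlinarith

end Moments

/-! ### Continuity of translation in L¹ -/

section Translation

variable {G : Type*} [NormedAddCommGroup G] [MeasurableSpace G] [BorelSpace G] [ProperSpace G]
  {μ : Measure G} [μ.IsAddHaarMeasure]

/-- Translations act continuously on integrable functions. -/
theorem exists_forall_integral_abs_translate_sub_le {k : G → ℝ} (hk : Integrable k μ)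
    {ε : ℝ} (hε : 0 < ε) :
    ∃ δ > 0, ∀ v : G, ‖v‖ ≤ δ → ∫ z, |k (v + z) - k z| ∂μ ≤ ε := by
  obtain ⟨g, hgc, hgk, hg, hgi⟩ := hk.exists_hasCompactSupport_integral_sub_le
    (ε := ε / 3) (by positivity)
  obtain ⟨M, hM⟩ := hgc.isCompact.isBounded.subset_closedBall (0 : G)
  -- The margin 1 makes both g and its translates by ‖v‖ ≤ 1 vanish outside D.
  set D : Set G := Metric.closedBall 0 (M + 1) with hD
  have hDfin : μ D < ∞ := measure_closedBall_lt_top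
  obtain ⟨η, hη, hηD⟩ : ∃ η > 0, η * μ.real D ≤ ε / 3 := by
    refine ⟨ε / 3 / (μ.real D + 1), by positivity, ?_⟩
    rw [div_mul_eq_mul_div, div_le_iff₀ (by positivity)]
    nlinarith [measureReal_nonneg (μ := μ) (s := D)]
  obtain ⟨δ, hδ, hu⟩ := Metric.uniformContinuous_iff.1 (hgc.uniformContinuous_of_continuous hg) η hη
  refine ⟨min (δ / 2) 1, by positivity, fun v hv => ?_⟩
  have hv1 : ‖v‖ ≤ 1 := hv.trans (min_le_right _ _)
  have hvδ : ‖v‖ < δ := by linarith [hv.trans (min_le_left _ _)]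
  have hmid : ∫ z, |g (v + z) - g z| ∂μ ≤ ε / 3 := by
    have hsupp : ∀ z, |g (v + z) - g z| ≤ D.indicator (fun _ => η) z := by
      intro z
      by_cases hz : z ∈ D
      · rw [Set.indicator_of_mem hz, ← Real.dist_eq]
        exact (hu (by simpa [dist_eq_norm] using hvδ)).le
      · have hz' : M + 1 < ‖z‖ := by simpa [hD] using hz
        have h1 : g z = 0 := by
          refine image_eq_zero_of_notMem_tsupport fun hh => ?_
          have := hM hh
          simp only [Metric.mem_closedBall, dist_zero_right] at this
          linarith
        have h2 : g (v + z) = 0 := by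
          refine image_eq_zero_of_notMem_tsupport fun hh => ?_
          have := hM hh
          simp only [Metric.mem_closedBall, dist_zero_right] at this
          have := norm_sub_le (v + z) v
          simp only [add_sub_cancel_left] at this
          linarith
        simp [h1, h2, hz]
    calc ∫ z, |g (v + z) - g z| ∂μ ≤ ∫ z, D.indicator (fun _ => η) z ∂μ :=
          integral_mono ((hgi.comp_add_left v).sub hgi).abs
            ((integrable_indicator_iff measurableSet_closedBall).2
              (integrableOn_const hDfin.ne)) hsupp
      _ = η * μ.real D := by
          rw [integral_indicator measurableSet_closedBall, setIntegral_const, smul_eq_mul, mul_comm]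
      _ ≤ ε / 3 := hηD
  have hkg : Integrable (fun z => |k z - g z|) μ := (hk.sub hgi).abs
  have hkg' : Integrable (fun z => |k (v + z) - g (v + z)|) μ := hkg.comp_add_left v
  have hgg : Integrable (fun z => |g (v + z) - g z|) μ := ((hgi.comp_add_left v).sub hgi).abs
  have hsum : Integrable (fun z => |k (v + z) - g (v + z)| + |g (v + z) - g z|) μ :=
    hkg'.add hgg
  have htr : ∫ z, |k (v + z) - g (v + z)| ∂μ = ∫ z, |k z - g z| ∂μ :=
    integral_add_left_eq_self (fun z => |k z - g z|) v
  calc ∫ z, |k (v + z) - k z| ∂μ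
      ≤ ∫ z, ((|k (v + z) - g (v + z)| + |g (v + z) - g z|) + |k z - g z|) ∂μ := by
        refine integral_mono ((hk.comp_add_left v).sub hk).abs ((hkg'.add hgg).add hkg)
          fun z => ?_
        have := abs_add_three (k (v + z) - g (v + z)) (g (v + z) - g z) (-(k z - g z))
        rw [abs_neg] at this
        refine le_trans (le_of_eq ?_) this
        ring_nf
    _ = (∫ z, |k (v + z) - g (v + z)| ∂μ + ∫ z, |g (v + z) - g z| ∂μ) + ∫ z, |k z - g z| ∂μ := by
        rw [integral_add hsum hkg, integral_add hkg' hgg]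
    _ ≤ ε := by
        rw [htr]
        simp only [Real.norm_eq_abs] at hgk
        linarith

end Translation

/-! ### Indicators are far from slowly varying functions -/

section Isoperimetry

/-- On the line: if a continuous function `g` oscillates by at most `1 / 4` at distances up to `δ`
and exceeds `3 / 4` somewhere, then it is at distance at least `1 / 4` from the indicator function
of a given bounded set on a set of length at least `2 δ`. -/
theorem two_mul_le_volume_abs_indicator_sub {g : ℝ → ℝ} {δ : ℝ} (hg : Continuous g)
    (hosc : ∀ x y, |x - y| ≤ δ → |g x - g y| ≤ 1 / 4) {F : Set ℝ} (hF : IsBounded F)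
    {x₀ : ℝ} (hx₀ : 3 / 4 ≤ g x₀) :
    ENNReal.ofReal (2 * δ) ≤ volume {x | 1 / 4 ≤ |F.indicator 1 x - g x|} := by
  have key : ∀ c : ℝ, (∀ x, |x - c| ≤ δ → 1 / 4 ≤ |F.indicator 1 x - g x|) →
      ENNReal.ofReal (2 * δ) ≤ volume {x | 1 / 4 ≤ |F.indicator 1 x - g x|} := by
    intro c hc
    rw [← Real.volume_closedBall c]
    exact measure_mono fun x hx => hc x (by simpa [Real.dist_eq] using hx)
  by_cases h : ∃ c, g c = 1 / 2
  · obtain ⟨c, hc⟩ := h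
    refine key c fun x hx => ?_
    have := abs_le.1 (hosc x c hx)
    rw [hc] at this
    by_cases hxF : x ∈ F
    · rw [Set.indicator_of_mem hxF, le_abs]
      left
      simp only [Pi.one_apply]
      linarith
    · rw [Set.indicator_of_notMem hxF, le_abs]
      right
      linarith
  · have hgt : ∀ x, 1 / 2 < g x := by
      intro x
      by_contra! hx
      obtain ⟨c, hc⟩ := mem_range_of_exists_le_of_exists_ge hg ⟨x, hx⟩
        ⟨x₀, (by linarith : (1 : ℝ) / 2 ≤ g x₀)⟩
      exact h ⟨c, hc⟩
    -- An interval of radius δ centred at M + δ + 1 lies beyond F, where the indicator is 0 and g >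
    -- 1/2.
    obtain ⟨M, hM⟩ := hF.subset_closedBall 0
    refine key (M + δ + 1) fun x hx => ?_
    have hxF : x ∉ F := by
      intro hxF
      have h1 := hM hxF
      simp only [Metric.mem_closedBall, dist_zero_right, Real.norm_eq_abs] at h1
      have h2 := le_abs_self x
      have h3 := abs_le.1 hx
      linarith
    rw [Set.indicator_of_notMem hxF, le_abs]
    right
    linarith [hgt x]

/-- If the vertical sections of `A` over the first projection of `H` have length at least `ℓ`,
then so does the corresponding area. -/
theorem mul_volume_fst_image_le {A : Set (ℝ × ℝ)} (hA : MeasurableSet A) (H : Set (ℝ × ℝ))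
    (ℓ : ℝ≥0∞) (h : ∀ p ∈ H, ℓ ≤ volume {y | (p.1, y) ∈ A}) :
    ℓ * volume (Prod.fst '' H) ≤ volume A := by
  rw [Measure.volume_eq_prod, Measure.prod_apply hA]
  refine le_trans ?_ (mul_meas_ge_le_lintegral (measurable_measure_prodMk_left hA) ℓ)
  gcongr
  rintro _ ⟨p, hp, rfl⟩
  exact h p hp

theorem mul_volume_snd_image_le {A : Set (ℝ × ℝ)} (hA : MeasurableSet A) (H : Set (ℝ × ℝ))
    (ℓ : ℝ≥0∞) (h : ∀ p ∈ H, ℓ ≤ volume {x | (x, p.2) ∈ A}) :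
    ℓ * volume (Prod.snd '' H) ≤ volume A := by
  rw [Measure.volume_eq_prod, Measure.prod_apply_symm hA]
  refine le_trans ?_ (mul_meas_ge_le_lintegral (measurable_measure_prodMk_right hA) ℓ)
  gcongr
  rintro _ ⟨p, hp, rfl⟩
  exact h p hp

/-- A Loomis–Whitney bound. -/
theorem sq_mul_volume_le_sq {A : Set (ℝ × ℝ)} (hA : MeasurableSet A) (H : Set (ℝ × ℝ))
    (ℓ : ℝ≥0∞) (h₁ : ∀ p ∈ H, ℓ ≤ volume {y | (p.1, y) ∈ A})
    (h₂ : ∀ p ∈ H, ℓ ≤ volume {x | (x, p.2) ∈ A}) :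
    ℓ ^ 2 * volume H ≤ volume A ^ 2 := by
  -- H lies in the product of its two projections, and ℓ times the length of each is at most |A|.
  calc ℓ ^ 2 * volume H ≤ ℓ ^ 2 * volume ((Prod.fst '' H) ×ˢ (Prod.snd '' H)) := by
        gcongr
        exact Set.subset_fst_image_prod_snd_image
    _ = (ℓ * volume (Prod.fst '' H)) * (ℓ * volume (Prod.snd '' H)) := by
        rw [Measure.volume_eq_prod, Measure.prod_prod]; ring
    _ ≤ volume A * volume A := by
        gcongr
        · exact mul_volume_fst_image_le hA H ℓ h₁
        · exact mul_volume_snd_image_le hA H ℓ h₂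
    _ = volume A ^ 2 := by ring

/-- An indicator function of a bounded set is far from any function `g` on the plane with
controlled oscillation, except where `g` is at most `3 / 4`. -/
theorem sq_mul_volume_superlevel_le {g : Plane → ℝ} {δ : ℝ} (hg : Continuous g)
    (hosc : ∀ x y, ‖x - y‖ ≤ δ → |g x - g y| ≤ 1 / 4) {F : Set Plane} (hF : IsBounded F)
    (hFm : MeasurableSet F) :
    ENNReal.ofReal (2 * δ) ^ 2 * volume {x | 3 / 4 ≤ g x}
      ≤ volume {x | 1 / 4 ≤ |F.indicator 1 x - g x|} ^ 2 := by
  let e : Plane ≃ᵐ ℝ × ℝ :=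
    (MeasurableEquiv.toLp 2 (Fin 2 → ℝ)).symm.trans MeasurableEquiv.finTwoArrow
  have he : MeasurePreserving e.symm volume volume :=
    ((volume_preserving_finTwoArrow ℝ).comp
      (EuclideanSpace.volume_preserving_symm_measurableEquiv_toLp (Fin 2))).symm e
  have hes : ∀ x y : ℝ, e.symm (x, y) = !₂[x, y] := fun x y => rfl
  have hgF : Measurable fun x => |F.indicator 1 x - g x| :=
    ((measurable_one.indicator hFm).sub hg.measurable).abs
  have hAm : MeasurableSet {x : Plane | 1 / 4 ≤ |F.indicator 1 x - g x|} :=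
    measurableSet_le measurable_const hgF
  have hHm : MeasurableSet {x : Plane | 3 / 4 ≤ g x} :=
    measurableSet_le measurable_const hg.measurable
  rw [← he.measure_preimage hHm.nullMeasurableSet, ← he.measure_preimage hAm.nullMeasurableSet]
  have hsec : ∀ γ : ℝ → Plane, Isometry γ → ∀ t₀, 3 / 4 ≤ g (γ t₀) →
      ENNReal.ofReal (2 * δ) ≤ volume {t | 1 / 4 ≤ |F.indicator 1 (γ t) - g (γ t)|} := by
    intro γ hγ t₀ ht₀
    have := two_mul_le_volume_abs_indicator_sub (g := fun t => g (γ t)) (F := γ ⁻¹' F)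
      (hg.comp hγ.continuous) (fun x y hxy => hosc _ _ (by
        rw [← dist_eq_norm, hγ.dist_eq, Real.dist_eq]; exact hxy))
      (hγ.antilipschitz.isBounded_preimage hF) ht₀
    exact this
  refine sq_mul_volume_le_sq (e.symm.measurable hAm) _ _ ?_ ?_
  · rintro ⟨a, b⟩ hp
    refine hsec (fun t => !₂[a, t]) (Isometry.of_dist_eq fun x y => ?_) b hp
    simp [EuclideanSpace.dist_eq, Fin.sum_univ_two, Real.sqrt_sq dist_nonneg]
  · rintro ⟨a, b⟩ hp
    refine hsec (fun t => !₂[t, b]) (Isometry.of_dist_eq fun x y => ?_) a hp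
    simp [EuclideanSpace.dist_eq, Fin.sum_univ_two, Real.sqrt_sq dist_nonneg]

end Isoperimetry

/-! ### Linear statistics of indicators as counts -/

namespace Configuration

theorem linearStatistic_indicator_one (s : Configuration) {R : ℝ} {E : Set Plane}
    (hE : IsBounded ((fun z : Plane => R⁻¹ • z) ⁻¹' E)) :
    s.linearStatistic R (E.indicator 1) = s.count ((fun z : Plane => R⁻¹ • z) ⁻¹' E) := by
  have hfin := s.finite_inter _ hE
  rw [count, Set.ncard_eq_toFinset_card _ hfin, linearStatistic, finsum_mem_def,
    finsum_eq_sum_of_support_subset (s := hfin.toFinset)]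
  · rw [Finset.cast_card]
    refine Finset.sum_congr rfl fun a ha => ?_
    obtain ⟨h1, h2⟩ := hfin.mem_toFinset.1 ha
    rw [Set.indicator_of_mem h1, Set.indicator_of_mem (Set.mem_preimage.1 h2), Pi.one_apply]
  · intro a ha
    rw [Function.mem_support] at ha
    simp only [Set.Finite.coe_toFinset]
    have h1 : a ∈ s.carrier := Set.mem_of_indicator_ne_zero ha
    rw [Set.indicator_of_mem h1] at ha
    exact ⟨h1, Set.mem_preimage.2 (Set.mem_of_indicator_ne_zero ha)⟩

end Configuration

/-! ### The lower bound for the variance -/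

section Moments

variable {Ω : Type*} [MeasurableSpace Ω] {P : Measure Ω} {Z : Ω → Configuration} {r : Plane → ℝ}

/-- A bounded Borel null set has expected count zero, so almost surely it contains no point. Since B
\ F need not be Borel, it is first enclosed in such a set. -/
theorem ae_count_eq_of_ae_eq (h1 : IsOnePointFunction P Z fun _ => 1) (hZ : Measurable Z)
    {F B : Set Plane} (hFB : F ⊆ B) (hb : IsBounded B) (h : F =ᵐ[volume] B) :
    ∀ᵐ ω ∂P, (Z ω).count F = (Z ω).count B := by
  obtain ⟨M, hM⟩ := hb.subset_closedBall (0 : Plane)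
  set N : Set Plane := toMeasurable volume (B \ F) ∩ Metric.closedBall 0 M with hN
  have hNm : MeasurableSet N := (measurableSet_toMeasurable _ _).inter measurableSet_closedBall
  have hNb : IsBounded N := Metric.isBounded_closedBall.subset Set.inter_subset_right
  have hN0 : volume N = 0 := measure_mono_null Set.inter_subset_left
    (by rw [measure_toMeasurable]; exact (ae_le_set.1 h.symm.le))
  have hsub : B \ F ⊆ N := fun x hx => ⟨subset_toMeasurable _ _ hx, hM hx.1⟩
  have h0 := lintegral_count_eq_volume h1 hNm hNb
  rw [hN0, lintegral_eq_zero_iff (measurable_count_comp hZ hNm hNb)] at h0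
  filter_upwards [h0] with ω hω
  have hω' : (Z ω).count N = 0 := by simpa using hω
  have he : (Z ω).carrier ∩ N = ∅ := by
    rwa [Configuration.count, Set.ncard_eq_zero ((Z ω).finite_inter _ hNb)] at hω'
  have : (Z ω).carrier ∩ F = (Z ω).carrier ∩ B := by
    refine Set.Subset.antisymm (Set.inter_subset_inter_right _ hFB) fun x hx => ⟨hx.1, ?_⟩
    by_contra hxF
    have : x ∈ (Z ω).carrier ∩ N := ⟨hx.1, hsub ⟨hx.2, hxF⟩⟩
    rw [he] at this
    exact this
  rw [Configuration.count, this, Configuration.count]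

/-- The bound does not involve F: this uniformity lets the final constant depend on r alone. -/
theorem abs_setIntegral_sub_sub_le {k : Plane → ℝ} (hk : Integrable k volume) (F : Set Plane)
    (x x' : Plane) :
    |(∫ y in F, k (x - y)) - ∫ y in F, k (x' - y)| ≤ ∫ z, |k (x - x' + z) - k z| := by
  have hi := hk.comp_sub_left x
  have hi' := hk.comp_sub_left x'
  rw [← integral_sub hi.integrableOn hi'.integrableOn]
  have hrw : ∀ y, |k (x - y) - k (x' - y)| = |k (x - x' + (x' - y)) - k (x' - y)| := by
    intro y
    rw [sub_add_sub_cancel]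
  calc |∫ y in F, (k (x - y) - k (x' - y))|
      ≤ ∫ y in F, |k (x - y) - k (x' - y)| := abs_integral_le_integral_abs
    _ ≤ ∫ y, |k (x - y) - k (x' - y)| :=
      setIntegral_le_integral (hi.sub hi').abs (Filter.Eventually.of_forall fun y => abs_nonneg _)
    _ = ∫ z, |k (x - x' + z) - k z| := by
      simp_rw [hrw]
      exact integral_sub_left_eq_self (fun z => |k (x - x' + z) - k z|) volume x'

theorem continuous_setIntegral_sub {k : Plane → ℝ} (hk : Integrable k volume) (F : Set Plane) :
    Continuous fun x => ∫ y in F, k (x - y) := by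
  rw [Metric.continuous_iff]
  intro x ε hε
  obtain ⟨δ, hδ, h⟩ := exists_forall_integral_abs_translate_sub_le hk (half_pos hε)
  refine ⟨δ, hδ, fun y hy => ?_⟩
  rw [Real.dist_eq]
  have := (abs_setIntegral_sub_sub_le hk F y x).trans (h (y - x) (by rw [← dist_eq_norm]; exact hy.le))
  linarith

/-- The variance of `#(Z ∩ F)` controls the area of the set where the convolution of `𝟙_F` with
the covariance measure is not small. -/
theorem volume_le_ofReal_variance_count [IsProbabilityMeasure P]
    (hr : Integrable (fun z => r z - 1) volume)
    (hZ : Measurable Z) (h1 : IsOnePointFunction P Z fun _ => 1)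
    (h2 : IsTwoPointFunction P Z fun z₁ z₂ => r (z₁ - z₂))
    {F : Set Plane} (hF : MeasurableSet F) (hbF : IsBounded F) {t : ℝ} (ht : 0 < t) :
    volume {x | t ≤ |F.indicator 1 x + ∫ y in F, (r (x - y) - 1)|}
      ≤ ENNReal.ofReal (2 / t ^ 2 * (1 + ∫ z, |r z - 1|)
          * Var[fun ω => ((Z ω).count F : ℝ); P]) := by
  set K := ∫ z, |r z - 1| with hK
  set V := Var[fun ω => ((Z ω).count F : ℝ); P] with hV
  set q : Plane → ℝ := fun x => F.indicator 1 x + ∫ y in F, (r (x - y) - 1) with hq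
  have hqm : Measurable q := (measurable_one.indicator hF).add
    (continuous_setIntegral_sub hr F).measurable
  have hqb : ∀ x, ‖q x‖ ≤ 1 + K := fun x => by
    refine (norm_add_le _ _).trans (add_le_add ?_ (abs_setIntegral_sub_le hr F x))
    by_cases hx : x ∈ F <;> simp [hx]
  have hqi : ∀ A : Set Plane, IsBounded A → IntegrableOn q A volume := fun A hA =>
    Measure.integrableOn_of_bounded hA.measure_lt_top.ne hqm.aestronglyMeasurable
      (Filter.Eventually.of_forall hqb)
  -- Covariances are available for bounded sets only, so the level set is cut by balls, with a bound
  -- uniform in n. The two signs of q account for the factor 2.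
  have hball : ∀ n : ℕ, volume ({x | t ≤ |q x|} ∩ Metric.closedBall 0 n)
      ≤ ENNReal.ofReal (2 / t ^ 2 * (1 + K) * V) := by
    intro n
    set Ap : Set Plane := {x | t ≤ q x} ∩ Metric.closedBall 0 n with hAp
    set An : Set Plane := {x | q x ≤ -t} ∩ Metric.closedBall 0 n with hAn
    have hApm : MeasurableSet Ap := (measurableSet_le measurable_const hqm).inter
      measurableSet_closedBall
    have hAnm : MeasurableSet An := (measurableSet_le hqm measurable_const).inter
      measurableSet_closedBall
    have hApb : IsBounded Ap := Metric.isBounded_closedBall.subset Set.inter_subset_right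
    have hAnb : IsBounded An := Metric.isBounded_closedBall.subset Set.inter_subset_right
    have hp : t ^ 2 * volume.real Ap ≤ (1 + K) * V := by
      refine volume_le_variance_count hr hZ h1 h2 hApm hApb hF hbF ht.le ?_
      exact (setIntegral_ge_of_const_le_real hApm hApb.measure_lt_top.ne (fun x hx => hx.1)
        (hqi _ hApb)).trans (le_abs_self _)
    have hn : t ^ 2 * volume.real An ≤ (1 + K) * V := by
      refine volume_le_variance_count hr hZ h1 h2 hAnm hAnb hF hbF ht.le ?_
      refine le_trans ?_ (neg_le_abs _)
      rw [← integral_neg]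
      exact setIntegral_ge_of_const_le_real hAnm hAnb.measure_lt_top.ne
        (fun x hx => le_neg_of_le_neg hx.1) (hqi _ hAnb).neg
    have hsub : {x | t ≤ |q x|} ∩ Metric.closedBall 0 n ⊆ Ap ∪ An := by
      rintro x ⟨hx, hxn⟩
      have hx' : t ≤ |q x| := hx
      rcases le_abs.1 hx' with h | h
      · exact Or.inl ⟨h, hxn⟩
      · exact Or.inr ⟨le_neg_of_le_neg h, hxn⟩
    refine (measure_mono hsub).trans ?_
    rw [← ofReal_measureReal (hApb.union hAnb).measure_lt_top.ne]
    refine ENNReal.ofReal_le_ofReal ((measureReal_union_le _ _).trans ?_)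
    rw [mul_assoc, div_mul_eq_mul_div, le_div_iff₀ (by positivity)]
    linarith
  have hun : {x | t ≤ |q x|} = ⋃ n : ℕ, {x | t ≤ |q x|} ∩ Metric.closedBall 0 n := by
    rw [← Set.inter_iUnion, Metric.iUnion_closedBall_nat, Set.inter_univ]
  rw [hun, Monotone.measure_iUnion]
  · exact iSup_le hball
  · intro i j hij
    exact Set.inter_subset_inter_right _ (Metric.closedBall_subset_closedBall (by exact_mod_cast hij))

/-- The lower bound of the variance of the number of points in a bounded Borel set. -/
theorem exists_forall_le_variance_count (hr : Integrable (fun z => r z - 1) volume) :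
    ∃ c : ℝ, 0 < c ∧
      ∀ (Ω : Type*) [MeasurableSpace Ω] (P : Measure Ω) [IsProbabilityMeasure P]
        (Z : Ω → Configuration), Measurable Z → IsOnePointFunction P Z (fun _ => 1) →
        IsTwoPointFunction P Z (fun z₁ z₂ => r (z₁ - z₂)) →
        ∀ F : Set Plane, MeasurableSet F → IsBounded F →
          c * min (volume.real F) √(volume.real F) ≤ Var[fun ω => ((Z ω).count F : ℝ); P] := by
  obtain ⟨δ, hδ, hosc⟩ := exists_forall_integral_abs_translate_sub_le hr
    (show (0 : ℝ) < 1 / 4 by norm_num)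
  have hK : 0 ≤ ∫ z, |r z - 1| := integral_nonneg fun z => abs_nonneg _
  set K := ∫ z, |r z - 1|
  -- Here 32 = 2 / (1/4)², from the threshold t = 1/4; the factors 1/2 and δ come from the two cases
  -- at the end.
  refine ⟨min (1 / 2) δ / (32 * (1 + K)), by positivity, ?_⟩
  intro Ω _ P _ Z hZ h1 h2 F hF hbF
  set V := Var[fun ω => ((Z ω).count F : ℝ); P] with hVdef
  have hV : 0 ≤ V := variance_nonneg _ _
  set g : Plane → ℝ := fun x => -∫ y in F, (r (x - y) - 1) with hg
  set A : Set Plane := {x | 1 / 4 ≤ |F.indicator 1 x - g x|} with hA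
  have hAV : volume A ≤ ENNReal.ofReal (32 * (1 + K) * V) := by
    have := volume_le_ofReal_variance_count hr hZ h1 h2 hF hbF (t := 1 / 4) (by norm_num)
    simp only [hA, hg, sub_neg_eq_add]
    refine this.trans_eq ?_
    norm_num [K, V]
  have hAfin : volume A ≠ ∞ := (hAV.trans_lt ENNReal.ofReal_lt_top).ne
  have hAV' : volume.real A ≤ 32 * (1 + K) * V :=
    ENNReal.toReal_le_of_le_ofReal (by positivity) hAV
  have hgoal : min (1 / 2) δ * min (volume.real F) √(volume.real F) ≤ volume.real A := by
    set H : Set Plane := {x | 3 / 4 ≤ g x} with hH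
    have hgeo := sq_mul_volume_superlevel_le (g := g) (continuous_setIntegral_sub hr F).neg
      (fun x y hxy => by
        have := (abs_setIntegral_sub_sub_le hr F x y).trans (hosc _ hxy)
        rwa [hg, neg_sub_neg, abs_sub_comm]) hbF hF
    -- On F outside H the difference 1 - g exceeds 1/4.
    have hcover : F ⊆ A ∪ (F ∩ H) := by
      intro x hx
      by_cases hxH : x ∈ H
      · exact Or.inr ⟨hx, hxH⟩
      · left
        have : g x < 3 / 4 := not_le.1 hxH
        simp only [hA, Set.mem_ofPred_eq, Set.indicator_of_mem hx, Pi.one_apply]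
        rw [le_abs]
        left
        linarith
    have hHfin : volume (F ∩ H) ≠ ∞ := (hbF.subset Set.inter_subset_left).measure_lt_top.ne
    have hsum : volume.real F ≤ volume.real A + volume.real (F ∩ H) :=
      (measureReal_mono hcover (by
        exact ((measure_union_le _ _).trans_lt
          (ENNReal.add_lt_top.2 ⟨hAfin.lt_top, hHfin.lt_top⟩)).ne)).trans (measureReal_union_le _ _)
    have hsq : (2 * δ) ^ 2 * volume.real (F ∩ H) ≤ volume.real A ^ 2 := by
      have h3 : ENNReal.ofReal (2 * δ) ^ 2 * volume (F ∩ H) ≤ volume A ^ 2 :=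
        le_trans (by gcongr; exact Set.inter_subset_right) hgeo
      have := ENNReal.toReal_mono (ENNReal.pow_ne_top hAfin) h3
      rwa [ENNReal.toReal_mul, ENNReal.toReal_pow, ENNReal.toReal_pow,
        ENNReal.toReal_ofReal (by positivity)] at this
    have hFn : 0 ≤ volume.real F := measureReal_nonneg
    have hmin : 0 ≤ min (volume.real F) √(volume.real F) := by positivity
    -- If |A| ≤ |F|/2, then |F ∩ H| ≥ |F|/2, and so |A|² ≥ 4δ²|F|/2 ≥ δ²|F|.
    rcases le_total (volume.real F / 2) (volume.real A) with h | h
    · calc min (1 / 2) δ * min (volume.real F) √(volume.real F)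
          ≤ 1 / 2 * volume.real F :=
            mul_le_mul (min_le_left _ _) (min_le_left _ _) hmin (by norm_num)
        _ ≤ volume.real A := by linarith
    · calc min (1 / 2) δ * min (volume.real F) √(volume.real F)
          ≤ δ * √(volume.real F) :=
            mul_le_mul (min_le_right _ _) (min_le_right _ _) hmin hδ.le
        _ ≤ volume.real A := by
            refine le_of_sq_le_sq ?_ measureReal_nonneg
            rw [mul_pow, Real.sq_sqrt hFn]
            nlinarith [sq_nonneg δ]
  rw [div_mul_eq_mul_div, div_le_iff₀ (by positivity)]
  linarith

end Moments

/-! ### Reduction to Borel sets and scaling -/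

/-- The conclusion includes that the linear statistic is square-integrable, so that its mean and
its variance are genuine. -/
theorem lemma1p6 (r : Plane → ℝ) (hr : Integrable (fun z => r z - 1) volume) :
    ∃ c : ℝ, 0 < c ∧
      ∀ (Ω : Type*) [MeasurableSpace Ω] (P : Measure Ω) [IsProbabilityMeasure P]
        (Z : Ω → Configuration), Measurable Z →
        IsTranslationInvariant P Z →
        IsOnePointFunction P Z (fun _ => 1) →
        IsTwoPointFunction P Z (fun z₁ z₂ => r (z₁ - z₂)) →
        ∀ E : Set Plane, NullMeasurableSet E volume → IsBounded E → 0 < volume E →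
        ∀ R : ℝ, 0 < R →
          MemLp (fun ω => (Z ω).linearStatistic R (E.indicator 1)) 2 P ∧
          c * min (volume.real E * R ^ 2) (√(volume.real E) * R)
            ≤ sigmaSq P Z R (E.indicator 1) := by
  obtain ⟨c, hc, h⟩ := exists_forall_le_variance_count hr
  refine ⟨c, hc, ?_⟩
  intro Ω _ P _ Z hZ _ h1 h2 E hE hbE _ R hR
  -- The counting bounds need a Borel set; passing to t changes the statistic only on a null event.
  obtain ⟨t, htE, ht, htae⟩ := hE.exists_measurable_subset_ae_eq
  set φ : Plane → Plane := fun z => R⁻¹ • z with hφ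
  have hφm : Measurable φ := measurable_const_smul _
  have hR' : R⁻¹ ≠ 0 := inv_ne_zero hR.ne'
  -- The preimage of S under φ is the dilate R S, whose area is R²|S|; this turns min(|F|, √|F|)
  -- into the stated minimum.
  have hvol : ∀ S : Set Plane, volume (φ ⁻¹' S) = ENNReal.ofReal (R ^ 2) * volume S := by
    intro S
    rw [hφ, Measure.addHaar_preimage_smul volume hR' S]
    congr 2
    rw [finrank_euclideanSpace_fin, inv_pow, inv_inv, abs_of_pos (by positivity)]
  have hφq : Measure.QuasiMeasurePreserving φ volume volume :=
    ⟨hφm, Measure.AbsolutelyContinuous.mk fun S hS h0 => by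
      rw [Measure.map_apply hφm hS, hvol, h0, mul_zero]⟩
  have hbB : IsBounded (φ ⁻¹' E) := by
    have := hbE.smul₀ R
    rwa [← Set.preimage_smul_inv₀ hR.ne'] at this
  have hbF : IsBounded (φ ⁻¹' t) := hbB.subset (Set.preimage_mono htE)
  have hF : MeasurableSet (φ ⁻¹' t) := hφm ht
  have hae : (fun ω => (Z ω).linearStatistic R (E.indicator 1)) =ᵐ[P]
      fun ω => ((Z ω).count (φ ⁻¹' t) : ℝ) := by
    filter_upwards [ae_count_eq_of_ae_eq h1 hZ (Set.preimage_mono htE) hbB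
      (hφq.preimage_ae_eq htae)] with ω hω
    rw [Configuration.linearStatistic_indicator_one _ hbB, hω]
  have hL := memLp_count hr hZ h1 h2 hF hbF
  refine ⟨(memLp_congr_ae hae).2 hL, ?_⟩
  have hvar : sigmaSq P Z R (E.indicator 1)
      = Var[fun ω => ((Z ω).count (φ ⁻¹' t) : ℝ); P] := by
    rw [← variance_congr hae, variance_eq_integral ((memLp_congr_ae hae).2 hL).aemeasurable, sigmaSq]
  have hreal : volume.real (φ ⁻¹' t) = volume.real E * R ^ 2 := by
    rw [Measure.real, hvol, measure_congr htae, ENNReal.toReal_mul,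
      ENNReal.toReal_ofReal (by positivity), mul_comm, Measure.real]
  have hsqrt : √(volume.real E) * R = √(volume.real (φ ⁻¹' t)) := by
    rw [hreal, Real.sqrt_mul measureReal_nonneg, Real.sqrt_sq hR.le]
  rw [hvar, hsqrt, ← hreal]
  exact h Ω P Z hZ h1 h2 _ hF hbF
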